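/- An \emph{étale, locally compact groupoid} is a groupoid $G$ with topologies on its arrow space (also denoted $G$) and its object space $G^0$ such that the range and source maps $r,s\colon G\rightrightarrows G^0$ are local homeomorphisms, multiplication $(g,h)\mapsto gh$ (defined for $s(g)=r(h)$) and inversion are continuous, and $G^0$ is Hausdorff and locally compact. A \emph{groupoid correspondence} $X\colon H\leftarrow G$ is a topological space $X$ with commuting continuous actions of $H$ on the left and of $G$ on the right, with continuous anchor maps $r\colon X\to H^0$ and $s\colon X\to G^0$, such that $s\colon X\to G^0$ is a local homeomorphism and the right action is free and proper, that is, the map $\{(x,g)\in X\times G : s(x)=r(g)\}\to X\times X$, $(x,g)\mapsto (x\cdot g,x)$, is injective and proper (universally closed). Commuting means $s(h\cdot x)=s(x)$, $r(x\cdot g)=r(x)$ and $(h\cdot x)\cdot g=h\cdot(x\cdot g)$ whenever $s(h)=r(x)$ and $s(x)=r(g)$. For $X\colon H\leftarrow G$ and $Y\colon G\leftarrow K$, let $X\circ_G Y$ be the orbit space, with the quotient topology, of the diagonal action $g\cdot(x,y)=(x\cdot g^{-1},g\cdot y)$ of $G$ on $\{(x,y)\in X\times Y : s(x)=r(y)\}$;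 let $[x,y]$ be the class of $(x,y)$, and put $r[x,y]=r(x)$, $s[x,y]=s(y)$, $h\cdot[x,y]=[h\cdot x,y]$, $[x,y]\cdot k=[x,y\cdot k]$. \textbf{Proposition.} The following data are well defined and form a bicategory $\mathfrak{Gr}$. \begin{itemize} \item The objects are the étale, locally compact groupoids. \item The arrows $G\to H$ are the groupoid correspondences $H\leftarrow G$. \item The $2$-arrows $X\Rightarrow X'$ between $X,X'\colon H\leftarrow G$ are the injective, continuous maps $\alpha\colon X\to X'$ that are $H,G$-equivariant (they preserve both anchor maps and both actions). Vertical composition is the composition of maps, and identity maps are the identity $2$-arrows. \item The composite of $X\colon H\leftarrow G$ and $Y\colon G\leftarrow K$ is $X\circ_G Y\colon H\leftarrow K$, which is again a groupoid correspondence. The horizontal composite of $2$-arrows $\alpha\colon X_1\Rightarrow X_2$ and $\beta\colon Y_1\Rightarrow Y_2$ is the $2$-arrow $X_1\circ_G Y_1\Rightarrow X_2\circ_G Y_2$, $[x,y]\mapsto[\alpha(x),\beta(y)]$. \item The identity arrow on $G$ is the arrow space of $G$ with the anchor maps $r,s$ and the actions by left and right multiplication, which is a groupoid correspondence $G\leftarrow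 G$. \item The unitors are the maps $H\circ_H X\to X$, $[h,x]\mapsto h\cdot x$, and $X\circ_G G\to X$, $[x,g]\mapsto x\cdot g$, for $X\colon H\leftarrow G$. The associator is the map $X_1\circ_{G_2}(X_2\circ_{G_3}X_3)\to(X_1\circ_{G_2}X_2)\circ_{G_3}X_3$, $[x_1,[x_2,x_3]]\mapsto[[x_1,x_2],x_3]$, for $X_i\colon G_i\leftarrow G_{i+1}$. These maps are biequivariant homeomorphisms. \end{itemize} -/

import Mathlib

open CategoryTheory Topology

universe u

/-- An étale, locally compact groupoid: a groupoid with object space `Obj` and arrow space `Arr`,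
whose range and source maps are local homeomorphisms, whose multiplication and inversion are
continuous, and whose object space is Hausdorff and locally compact. The product `mul g h` is
defined for `s g = r h`. The arrow space need not be Hausdorff. -/
structure EtaleGroupoid where
  Obj : Type u
  Arr : Type u
  [topObj : TopologicalSpace Obj]
  [topArr : TopologicalSpace Arr]
  r : Arr → Obj
  s : Arr → Obj
  unit : Obj → Arr
  inv : Arr → Arr
  mul : ∀ g h : Arr, s g = r h → Arr
  r_unit : ∀ x, r (unit x) = x
  s_unit : ∀ x, s (unit x) = x
  r_inv : ∀ g, r (inv g) = s g
  s_inv : ∀ g, s (inv g) = r g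
  r_mul : ∀ g h e, r (mul g h e) = r g
  s_mul : ∀ g h e, s (mul g h e) = s h
  unit_mul : ∀ g, mul (unit (r g)) g (s_unit (r g)) = g
  mul_unit : ∀ g, mul g (unit (s g)) (r_unit (s g)).symm = g
  mul_assoc : ∀ g h k (e₁ : s g = r h) (e₂ : s h = r k),
    mul (mul g h e₁) k ((s_mul g h e₁).trans e₂) =
      mul g (mul h k e₂) (e₁.trans (r_mul h k e₂).symm)
  inv_mul : ∀ g, mul (inv g) g (s_inv g) = unit (s g)
  mul_inv : ∀ g, mul g (inv g) (r_inv g).symm = unit (r g)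
  isLocalHomeomorph_r : IsLocalHomeomorph r
  isLocalHomeomorph_s : IsLocalHomeomorph s
  continuous_mul : Continuous fun p : {p : Arr × Arr // s p.1 = r p.2} => mul p.1.1 p.1.2 p.2
  continuous_inv : Continuous inv
  t2Space_obj : T2Space Obj
  locallyCompactSpace_obj : LocallyCompactSpace Obj

namespace EtaleGroupoid

attribute [instance] topObj topArr

attribute [simp] r_unit s_unit r_inv s_inv r_mul s_mul unit_mul mul_unit inv_mul mul_inv

variable (G : EtaleGroupoid.{u})

theorem eq_inv_of_mul_eq_unit (g h : G.Arr) (e : G.s g = G.r h)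
    (H : G.mul g h e = G.unit (G.r g)) : h = G.inv g := by
  have h1 := G.mul_assoc (G.inv g) g h (G.s_inv g) e
  simp only [inv_mul, H, e] at h1
  rw [G.unit_mul h] at h1
  rw [h1]
  have h2 := G.mul_unit (G.inv g)
  simp only [s_inv] at h2
  exact h2

@[simp] theorem inv_unit (x : G.Obj) : G.inv (G.unit x) = G.unit x := by
  symm
  apply G.eq_inv_of_mul_eq_unit (G.unit x) (G.unit x) (by simp)
  have := G.mul_unit (G.unit x)
  simp only [s_unit] at this
  simpa using this

@[simp] theorem inv_inv (g : G.Arr) : G.inv (G.inv g) = g :=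
  (G.eq_inv_of_mul_eq_unit (G.inv g) g (by simp) (by simp)).symm

theorem inv_mul_rev (g h : G.Arr) (e : G.s g = G.r h) :
    G.inv (G.mul g h e) = G.mul (G.inv h) (G.inv g) (by simp [e]) := by
  symm
  apply G.eq_inv_of_mul_eq_unit _ _ (by simp)
  rw [G.mul_assoc g h _ e (by simp)]
  have h1 : G.mul h (G.mul (G.inv h) (G.inv g) (by simp [e])) (by simp) = G.inv g := by
    rw [← G.mul_assoc h (G.inv h) (G.inv g) (by simp) (by simp [e])]
    have := G.unit_mul (G.inv g)
    simp only [r_inv, e] at this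
    simpa using this
  simp only [h1]
  simp

end EtaleGroupoid

/-- A topological space with commuting actions of `H` on the left (with anchor map `r`) and of `G`
on the right (with anchor map `s`). All topological conditions are in
`PreCorrespondence.IsCorrespondence`. -/
structure PreCorrespondence (H G : EtaleGroupoid.{u}) where
  carrier : Type u
  [top : TopologicalSpace carrier]
  r : carrier → H.Obj
  s : carrier → G.Obj
  lact : ∀ (h : H.Arr) (x : carrier), H.s h = r x → carrier
  ract : ∀ (x : carrier) (g : G.Arr), s x = G.r g → carrier
  r_lact : ∀ h x e, r (lact h x e) = H.r h
  lact_lact : ∀ h₁ h₂ x (e₁ : H.s h₁ = H.r h₂) (e₂ : H.s h₂ = r x),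
    lact h₁ (lact h₂ x e₂) (e₁.trans (r_lact h₂ x e₂).symm) =
      lact (H.mul h₁ h₂ e₁) x ((H.s_mul h₁ h₂ e₁).trans e₂)
  unit_lact : ∀ x, lact (H.unit (r x)) x (H.s_unit (r x)) = x
  s_ract : ∀ x g e, s (ract x g e) = G.s g
  ract_ract : ∀ x g₁ g₂ (e₁ : s x = G.r g₁) (e₂ : G.s g₁ = G.r g₂),
    ract (ract x g₁ e₁) g₂ ((s_ract x g₁ e₁).trans e₂) =
      ract x (G.mul g₁ g₂ e₂) (e₁.trans (G.r_mul g₁ g₂ e₂).symm)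
  ract_unit : ∀ x, ract x (G.unit (s x)) (G.r_unit (s x)).symm = x
  s_lact : ∀ h x e, s (lact h x e) = s x
  r_ract : ∀ x g e, r (ract x g e) = r x
  lact_ract : ∀ h x g (e₁ : H.s h = r x) (e₂ : s x = G.r g),
    ract (lact h x e₁) g ((s_lact h x e₁).trans e₂) =
      lact h (ract x g e₂) (e₁.trans (r_ract x g e₂).symm)

namespace PreCorrespondence

attribute [instance] top

attribute [simp] r_lact s_ract s_lact r_ract unit_lact ract_unit

variable {H G K L : EtaleGroupoid.{u}}

/-- The map `(x, g) ↦ (x · g, x)` that encodes freeness and properness of the right action. -/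
def actionMap (X : PreCorrespondence H G) :
    {p : X.carrier × G.Arr // X.s p.1 = G.r p.2} → X.carrier × X.carrier :=
  fun p => (X.ract p.1.1 p.1.2 p.2, p.1.1)

/-- The anchor maps and the actions are continuous, the right anchor map is a local homeomorphism,
and the right action is free and proper (`IsProperMap` means universally closed). -/
structure IsCorrespondence (X : PreCorrespondence H G) : Prop where
  continuous_r : Continuous X.r
  continuous_lact : Continuous
    fun p : {p : H.Arr × X.carrier // H.s p.1 = X.r p.2} => X.lact p.1.1 p.1.2 p.2
  continuous_ract : Continuous
    fun p : {p : X.carrier × G.Arr // X.s p.1 = G.r p.2} => X.ract p.1.1 p.1.2 p.2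
  isLocalHomeomorph_s : IsLocalHomeomorph X.s
  free : Function.Injective X.actionMap
  proper : IsProperMap X.actionMap

/-- An injective, biequivariant, continuous map. -/
structure IsTwoArrow (X Y : PreCorrespondence H G) (f : X.carrier → Y.carrier) : Prop where
  continuous : Continuous f
  injective : Function.Injective f
  map_r : ∀ x, Y.r (f x) = X.r x
  map_s : ∀ x, Y.s (f x) = X.s x
  map_lact : ∀ h x (e : H.s h = X.r x), f (X.lact h x e) = Y.lact h (f x) (e.trans (map_r x).symm)
  map_ract : ∀ x g (e : X.s x = G.r g), f (X.ract x g e) = Y.ract (f x) g ((map_s x).trans e)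

/-- The arrow space of `G` with the actions by left and right multiplication. -/
abbrev identity (G : EtaleGroupoid.{u}) : PreCorrespondence G G where
  carrier := G.Arr
  r := G.r
  s := G.s
  lact := G.mul
  ract := G.mul
  r_lact := G.r_mul
  lact_lact h₁ h₂ x e₁ e₂ := (G.mul_assoc h₁ h₂ x e₁ e₂).symm
  unit_lact := G.unit_mul
  s_ract := G.s_mul
  ract_ract := G.mul_assoc
  ract_unit := G.mul_unit
  s_lact := G.s_mul
  r_ract := G.r_mul
  lact_ract := G.mul_assoc

/-- The fibre product of `X` and `Y` over the object space of `G`. -/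
abbrev FibreProduct (X : PreCorrespondence H G) (Y : PreCorrespondence G K) : Type u :=
  {p : X.carrier × Y.carrier // X.s p.1 = Y.r p.2}

/-- The diagonal action `g · (x, y) = (x · g⁻¹, g · y)` for `s g = r y = s x`. -/
def diag (X : PreCorrespondence H G) (Y : PreCorrespondence G K) (g : G.Arr)
    (p : FibreProduct X Y) (e : G.s g = Y.r p.1.2) : FibreProduct X Y :=
  ⟨(X.ract p.1.1 (G.inv g) ((p.2.trans e.symm).trans (G.r_inv g).symm), Y.lact g p.1.2 e),
    by simp⟩

/-- The orbit equivalence relation of the diagonal action. -/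
def orbitSetoid (X : PreCorrespondence H G) (Y : PreCorrespondence G K) :
    Setoid (FibreProduct X Y) where
  r p q := ∃ (g : G.Arr) (e : G.s g = Y.r p.1.2), diag X Y g p e = q
  iseqv :=
    { refl := fun p => by
        obtain ⟨⟨x, y⟩, e⟩ := p
        refine ⟨G.unit (Y.r y), by simp, ?_⟩
        have h := X.ract_unit x
        simp only [show X.s x = Y.r y from e] at h
        simp [diag, h]
      symm := by
        rintro ⟨⟨x, y⟩, e⟩ q ⟨g, hg, rfl⟩
        have e' : X.s x = Y.r y := e
        have hg' : G.s g = Y.r y := hg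
        refine ⟨G.inv g, by simp [diag], ?_⟩
        have h := X.ract_unit x
        simp only [e'] at h
        have h' := Y.unit_lact y
        simp [diag, ract_ract, lact_lact, hg', h]
      trans := by
        rintro ⟨⟨x, y⟩, e⟩ q q' ⟨g, hg, rfl⟩ ⟨g', hg', rfl⟩
        have h1 : G.s g' = G.r g := by simpa [diag] using hg'
        refine ⟨G.mul g' g h1, by simpa using hg, ?_⟩
        simp [diag, ract_ract, lact_lact, G.inv_mul_rev, h1] }

/-- The composite `X ∘_G Y` as a topological space: the orbit space of the diagonal action on the
fibre product, with the quotient topology. -/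
abbrev CompSpace (X : PreCorrespondence H G) (Y : PreCorrespondence G K) : Type u :=
  Quotient (orbitSetoid X Y)

/-- The class `[x, y]` in `X ∘_G Y`. -/
def cls (X : PreCorrespondence H G) (Y : PreCorrespondence G K) (x : X.carrier) (y : Y.carrier)
    (e : X.s x = Y.r y) : CompSpace X Y :=
  Quotient.mk (orbitSetoid X Y) ⟨(x, y), e⟩

section

variable (X : PreCorrespondence H G) (Y : PreCorrespondence G K) (Z : PreCorrespondence K L)

theorem cls_surj (q : CompSpace X Y) : ∃ x y e, q = cls X Y x y e := by
  obtain ⟨⟨⟨x, y⟩, e⟩, rfl⟩ := Quotient.exists_rep q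
  exact ⟨x, y, e, rfl⟩

theorem cls_eq_iff {x x' y y' e e'} : cls X Y x y e = cls X Y x' y' e' ↔
    ∃ (g : G.Arr) (hg : G.s g = Y.r y),
      X.ract x (G.inv g) ((e.trans hg.symm).trans (G.r_inv g).symm) = x' ∧ Y.lact g y hg = y' := by
  constructor
  · intro h
    obtain ⟨g, hg, h⟩ := Quotient.exact h
    have := congrArg Subtype.val h
    exact ⟨g, hg, congrArg Prod.fst this, congrArg Prod.snd this⟩
  · rintro ⟨g, hg, rfl, rfl⟩
    exact Quotient.sound ⟨g, hg, rfl⟩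

/-- `r [x, y] = r x`. -/
def compR : CompSpace X Y → H.Obj :=
  Quotient.lift (fun p => X.r p.1.1) (by rintro p q ⟨g, e, rfl⟩; simp [diag])

/-- `s [x, y] = s y`. -/
def compS : CompSpace X Y → K.Obj :=
  Quotient.lift (fun p => Y.s p.1.2) (by rintro p q ⟨g, e, rfl⟩; simp [diag])

/-- `h · [x, y] = [h · x, y]`. -/
def compLact (h : H.Arr) (q : CompSpace X Y) (e : H.s h = compR X Y q) : CompSpace X Y :=
  q.pliftOn
    (fun p hp => cls X Y (X.lact h p.1.1 (e.trans (congrArg (compR X Y) hp))) p.1.2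
      ((X.s_lact _ _ _).trans p.2))
    (by
      rintro p p' - - ⟨g, hg, rfl⟩
      rw [cls_eq_iff]
      exact ⟨g, hg, X.lact_ract _ _ _ _ _, rfl⟩)

/-- `[x, y] · k = [x, y · k]`. -/
def compRact (q : CompSpace X Y) (k : K.Arr) (e : compS X Y q = K.r k) : CompSpace X Y :=
  q.pliftOn
    (fun p hp => cls X Y p.1.1 (Y.ract p.1.2 k ((congrArg (compS X Y) hp).symm.trans e))
      (p.2.trans (Y.r_ract _ _ _).symm))
    (by
      rintro p p' - - ⟨g, hg, rfl⟩
      rw [cls_eq_iff]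
      exact ⟨g, hg.trans (Y.r_ract _ _ _).symm, rfl, (Y.lact_ract _ _ _ _ _).symm⟩)

@[simp] theorem compR_cls (x y e) : compR X Y (cls X Y x y e) = X.r x := rfl

@[simp] theorem compS_cls (x y e) : compS X Y (cls X Y x y e) = Y.s y := rfl

@[simp] theorem compLact_cls (h x y e e') :
    compLact X Y h (cls X Y x y e) e' = cls X Y (X.lact h x e') y ((X.s_lact _ _ _).trans e) := rfl

@[simp] theorem compRact_cls (x y k e e') :
    compRact X Y (cls X Y x y e) k e' = cls X Y x (Y.ract y k e') (e.trans (Y.r_ract _ _ _).symm) :=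
  rfl

/-- The composite `X ∘_G Y` of `X : H ← G` and `Y : G ← K`. -/
abbrev comp : PreCorrespondence H K where
  carrier := CompSpace X Y
  r := compR X Y
  s := compS X Y
  lact := compLact X Y
  ract := compRact X Y
  r_lact h q e := by
    obtain ⟨x, y, e', rfl⟩ := cls_surj X Y q
    exact X.r_lact h x e
  lact_lact h₁ h₂ q e₁ e₂ := by
    obtain ⟨x, y, e', rfl⟩ := cls_surj X Y q
    have h := X.lact_lact h₁ h₂ x e₁ e₂
    simp only [compLact_cls, h]
  unit_lact q := by
    obtain ⟨x, y, e', rfl⟩ := cls_surj X Y q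
    simp
  s_ract q k e := by
    obtain ⟨x, y, e', rfl⟩ := cls_surj X Y q
    exact Y.s_ract y k e
  ract_ract q k₁ k₂ e₁ e₂ := by
    obtain ⟨x, y, e', rfl⟩ := cls_surj X Y q
    have h := Y.ract_ract y k₁ k₂ e₁ e₂
    simp only [compRact_cls, h]
  ract_unit q := by
    obtain ⟨x, y, e', rfl⟩ := cls_surj X Y q
    simp
  s_lact h q e := by
    obtain ⟨x, y, e', rfl⟩ := cls_surj X Y q
    simp
  r_ract q k e := by
    obtain ⟨x, y, e', rfl⟩ := cls_surj X Y q
    simp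
  lact_ract h q k e₁ e₂ := by
    obtain ⟨x, y, e', rfl⟩ := cls_surj X Y q
    simp

theorem ract_inv_mul (x : X.carrier) (g a : G.Arr) (e : X.s x = G.r a) (hg : G.s g = G.r a) :
    X.ract (X.ract x (G.inv g) (by simp [e, hg])) (G.mul g a hg) (by simp) = X.ract x a e := by
  have h1 : G.mul (G.inv g) (G.mul g a hg) (by simp) = a := by
    rw [← G.mul_assoc _ _ _ (by simp) hg]
    simp [hg]
  rw [X.ract_ract _ _ _ _ (by simp)]
  simp only [h1]

theorem mul_inv_lact (a g : H.Arr) (x : X.carrier) (e : H.s a = X.r x) (hg : H.s g = X.r x) :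
    X.lact (H.mul a (H.inv g) (by simp [e, hg])) (X.lact g x hg) (by simp) = X.lact a x e := by
  have h := H.mul_unit a
  have h1 : H.mul (H.mul a (H.inv g) (by simp [e, hg])) g (by simp) = a := by
    rw [H.mul_assoc _ _ _ _ (by simp)]
    simpa [hg, e] using h
  rw [X.lact_lact _ _ _ (by simp)]
  simp only [h1]

/-- The map `X ∘_G 1_G → X`, `[x, g] ↦ x · g`. -/
def unitorR : (X.comp (identity G)).carrier → X.carrier :=
  Quotient.lift (fun p : FibreProduct X (identity G) => X.ract p.1.1 p.1.2 p.2) (by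
    rintro ⟨⟨x, a⟩, e⟩ q ⟨g, hg, rfl⟩
    exact (X.ract_inv_mul x g a e hg).symm)

/-- The map `1_H ∘_H X → X`, `[h, x] ↦ h · x`. -/
def unitorL : ((identity H).comp X).carrier → X.carrier :=
  Quotient.lift (fun p : FibreProduct (identity H) X => X.lact p.1.1 p.1.2 p.2) (by
    rintro ⟨⟨a, x⟩, e⟩ q ⟨g, hg, rfl⟩
    exact (X.mul_inv_lact a g x e hg).symm)

/-- The map `Y ∘_K Z → (X ∘_G Y) ∘_K Z`, `[y, z] ↦ [[x, y], z]`, for fixed `x`, defined on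
the classes `q` with `r q = s x`. -/
def assocAux (x : X.carrier) (q : (Y.comp Z).carrier) (e : X.s x = (Y.comp Z).r q) :
    ((X.comp Y).comp Z).carrier :=
  Quotient.pliftOn (s := orbitSetoid Y Z) q
    (fun p hp => cls (X.comp Y) Z (cls X Y x p.1.1 (e.trans (congrArg (compR Y Z) hp))) p.1.2 p.2)
    (by
      rintro p p' - - ⟨k, hk, rfl⟩
      exact (cls_eq_iff (X.comp Y) Z).2 ⟨k, hk, rfl, rfl⟩)

/-- The map `X ∘_G (Y ∘_K Z) → (X ∘_G Y) ∘_K Z`, `[x, [y, z]] ↦ [[x, y], z]`. -/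
def assoc : (X.comp (Y.comp Z)).carrier → ((X.comp Y).comp Z).carrier :=
  Quotient.lift (fun p : FibreProduct X (Y.comp Z) => assocAux X Y Z p.1.1 p.1.2 p.2) (by
    rintro ⟨⟨x, q⟩, e⟩ q' ⟨g, hg, rfl⟩
    obtain ⟨y, z, e', rfl⟩ := cls_surj Y Z q
    change cls (X.comp Y) Z (cls X Y _ _ _) _ _ = cls (X.comp Y) Z (cls X Y _ _ _) _ _
    congr 1
    exact (cls_eq_iff X Y).2 ⟨g, hg, rfl, rfl⟩)

theorem unitorR_cls (x g e) : unitorR X (cls X (identity G) x g e) = X.ract x g e := rfl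

theorem unitorL_cls (h x e) : unitorL X (cls (identity H) X h x e) = X.lact h x e := rfl

theorem assoc_cls (x y z) (e : X.s x = Y.r y) (e' : Y.s y = Z.r z) :
    assoc X Y Z (cls X (Y.comp Z) x (cls Y Z y z e') e) =
      cls (X.comp Y) Z (cls X Y x y e) z e' := rfl

end

/-- The map `X₁ ∘_G Y₁ → X₂ ∘_G Y₂`, `[x, y] ↦ [α x, β y]`. -/
def hcomp {X₁ X₂ : PreCorrespondence H G} {Y₁ Y₂ : PreCorrespondence G K}
    {α : X₁.carrier → X₂.carrier} {β : Y₁.carrier → Y₂.carrier}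
    (hα : IsTwoArrow X₁ X₂ α) (hβ : IsTwoArrow Y₁ Y₂ β) :
    (X₁.comp Y₁).carrier → (X₂.comp Y₂).carrier :=
  Quotient.lift
    (fun p : FibreProduct X₁ Y₁ =>
      cls X₂ Y₂ (α p.1.1) (β p.1.2) (((hα.map_s _).trans p.2).trans (hβ.map_r _).symm))
    (by
      rintro ⟨⟨x, y⟩, e⟩ q ⟨g, hg, rfl⟩
      exact (cls_eq_iff X₂ Y₂).2 ⟨g, hg.trans (hβ.map_r _).symm, (hα.map_ract _ _ _).symm,
        (hβ.map_lact _ _ _).symm⟩)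

end PreCorrespondence

/-- A groupoid correspondence `H ← G`. -/
structure Correspondence (H G : EtaleGroupoid.{u}) extends PreCorrespondence H G where
  isCorrespondence : toPreCorrespondence.IsCorrespondence

namespace Correspondence

variable {H G K L : EtaleGroupoid.{u}}

/-- A 2-arrow `X ⇒ Y`. -/
@[ext]
structure TwoArrow (X Y : Correspondence H G) where
  toFun : X.carrier → Y.carrier
  isTwoArrow : X.toPreCorrespondence.IsTwoArrow Y.toPreCorrespondence toFun

/-- The category of groupoid correspondences `H ← G`, with the 2-arrows as morphisms and the
composition of maps as composition. -/
instance : Category.{u} (Correspondence H G) where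
  Hom := TwoArrow
  id X :=
    { toFun := id
      isTwoArrow := ⟨continuous_id, Function.injective_id, fun _ => rfl, fun _ => rfl,
        fun _ _ _ => rfl, fun _ _ _ => rfl⟩ }
  comp α β :=
    { toFun := β.toFun ∘ α.toFun
      isTwoArrow :=
        { continuous := β.isTwoArrow.continuous.comp α.isTwoArrow.continuous
          injective := β.isTwoArrow.injective.comp α.isTwoArrow.injective
          map_r := fun x => (β.isTwoArrow.map_r _).trans (α.isTwoArrow.map_r x)
          map_s := fun x => (β.isTwoArrow.map_s _).trans (α.isTwoArrow.map_s x)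
          map_lact := fun h x e => by
            simp [α.isTwoArrow.map_lact, β.isTwoArrow.map_lact]
          map_ract := fun x g e => by
            simp [α.isTwoArrow.map_ract, β.isTwoArrow.map_ract] } }

/-- The isomorphism of groupoid correspondences given by a biequivariant homeomorphism. -/
noncomputable def isoOfIsHomeomorph {X Y : Correspondence H G} (f : X.carrier → Y.carrier)
    (hf : X.toPreCorrespondence.IsTwoArrow Y.toPreCorrespondence f) (hf' : IsHomeomorph f) :
    X ≅ Y where
  hom := ⟨f, hf⟩
  inv :=
    { toFun := (hf'.homeomorph f).symm
      isTwoArrow :=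
        { continuous := (hf'.homeomorph f).symm.continuous
          injective := (hf'.homeomorph f).symm.injective
          map_r := fun y => by
            obtain ⟨x, rfl⟩ := hf'.surjective y
            exact (congrArg X.r ((hf'.homeomorph f).symm_apply_apply x)).trans (hf.map_r x).symm
          map_s := fun y => by
            obtain ⟨x, rfl⟩ := hf'.surjective y
            exact (congrArg X.s ((hf'.homeomorph f).symm_apply_apply x)).trans (hf.map_s x).symm
          map_lact := fun h y e => by
            obtain ⟨x, rfl⟩ := hf'.surjective y
            have hx := (hf'.homeomorph f).symm_apply_apply x
            change (hf'.homeomorph f).symm (f x) = x at hx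
            apply hf'.injective
            simp only [hx, hf.map_lact]
            exact (hf'.homeomorph f).apply_symm_apply _
          map_ract := fun y g e => by
            obtain ⟨x, rfl⟩ := hf'.surjective y
            have hx := (hf'.homeomorph f).symm_apply_apply x
            change (hf'.homeomorph f).symm (f x) = x at hx
            apply hf'.injective
            simp only [hx, hf.map_ract]
            exact (hf'.homeomorph f).apply_symm_apply _ } }
  hom_inv_id := TwoArrow.ext (funext fun x => (hf'.homeomorph f).symm_apply_apply x)
  inv_hom_id := TwoArrow.ext (funext fun y => (hf'.homeomorph f).apply_symm_apply y)

end Correspondence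

/-- The data of a bicategory in the sense of Bénabou, without any laws except that the arrows
between two fixed objects and their 2-arrows form a category. The composite of `f : a → b` and
`g : b → c` is `comp f g`, and `hcomp` is the horizontal composition of 2-arrows. -/
structure BicategoryData (B : Type (u + 1)) where
  Hom : B → B → Type (u + 1)
  homCategory : ∀ a b, Category.{u} (Hom a b)
  id : ∀ a, Hom a a
  comp : ∀ {a b c}, Hom a b → Hom b c → Hom a c
  hcomp : ∀ {a b c} {f f' : Hom a b} {g g' : Hom b c}, (f ⟶ f') → (g ⟶ g') →
    (comp f g ⟶ comp f' g')
  associator : ∀ {a b c d} (f : Hom a b) (g : Hom b c) (h : Hom c d),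
    comp (comp f g) h ≅ comp f (comp g h)
  leftUnitor : ∀ {a b} (f : Hom a b), comp (id a) f ≅ f
  rightUnitor : ∀ {a b} (f : Hom a b), comp f (id b) ≅ f

/-- The data that underlies a bicategory. -/
def BicategoryData.ofBicategory {B : Type (u + 1)} (I : Bicategory.{u, u + 1} B) :
    BicategoryData B where
  Hom a b := a ⟶ b
  homCategory := I.homCategory
  id := I.id
  comp f g := f ≫ g
  hcomp {_ _ _ _ f' g _} η θ := I.whiskerRight η g ≫ I.whiskerLeft f' θ
  associator := I.associator
  leftUnitor := I.leftUnitor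
  rightUnitor := I.rightUnitor

/-- The constructions on groupoid correspondences yield groupoid correspondences, 2-arrows and
biequivariant homeomorphisms, respectively. -/
structure CorrespondencesWellDefined : Prop where
  identity : ∀ G : EtaleGroupoid.{u}, (PreCorrespondence.identity G).IsCorrespondence
  comp : ∀ {H G K : EtaleGroupoid.{u}} (X : Correspondence H G) (Y : Correspondence G K),
    (X.toPreCorrespondence.comp Y.toPreCorrespondence).IsCorrespondence
  hcomp : ∀ {H G K : EtaleGroupoid.{u}} {X₁ X₂ : Correspondence H G} {Y₁ Y₂ : Correspondence G K}
    (α : X₁ ⟶ X₂) (β : Y₁ ⟶ Y₂), PreCorrespondence.IsTwoArrow _ _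
      (PreCorrespondence.hcomp α.isTwoArrow β.isTwoArrow)
  unitorR : ∀ {H G : EtaleGroupoid.{u}} (X : Correspondence H G),
    PreCorrespondence.IsTwoArrow _ _ X.unitorR ∧ IsHomeomorph X.unitorR
  unitorL : ∀ {H G : EtaleGroupoid.{u}} (X : Correspondence H G),
    PreCorrespondence.IsTwoArrow _ _ X.unitorL ∧ IsHomeomorph X.unitorL
  assoc : ∀ {H G K L : EtaleGroupoid.{u}} (X : Correspondence H G) (Y : Correspondence G K)
    (Z : Correspondence K L),
    PreCorrespondence.IsTwoArrow _ _ (PreCorrespondence.assoc X.toPreCorrespondence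
      Y.toPreCorrespondence Z.toPreCorrespondence) ∧
    IsHomeomorph (PreCorrespondence.assoc X.toPreCorrespondence
      Y.toPreCorrespondence Z.toPreCorrespondence)

/-- The data of the bicategory of groupoid correspondences. An arrow `G → H` is a groupoid
correspondence `H ← G`, so the composite of `Y : K → G` and `X : G → H` is `X ∘_G Y`. -/
noncomputable def correspondenceData (W : CorrespondencesWellDefined.{u}) :
    BicategoryData EtaleGroupoid.{u} where
  Hom G H := Correspondence H G
  homCategory _ _ := inferInstance
  id G := ⟨PreCorrespondence.identity G, W.identity G⟩
  comp Y X := ⟨X.toPreCorrespondence.comp Y.toPreCorrespondence, W.comp X Y⟩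
  hcomp β α := ⟨PreCorrespondence.hcomp α.isTwoArrow β.isTwoArrow, W.hcomp α β⟩
  associator Z Y X := Correspondence.isoOfIsHomeomorph
    (PreCorrespondence.assoc X.toPreCorrespondence Y.toPreCorrespondence Z.toPreCorrespondence)
    (W.assoc X Y Z).1 (W.assoc X Y Z).2
  leftUnitor X := Correspondence.isoOfIsHomeomorph X.unitorR (W.unitorR X).1 (W.unitorR X).2
  rightUnitor X := Correspondence.isoOfIsHomeomorph X.unitorL (W.unitorL X).1 (W.unitorL X).2

/-! The algebraic laws can be checked on representatives; the real content is topological. It rests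
on the orbit map from the fibre product to `X ∘_G Y` being open (`isOpenQuotientMap_mk`), which
holds because the source map of `G` is open. Open quotient maps, unlike general quotient maps,
survive products and restriction to preimages, so continuity of the actions, defined on fibre
products, can be tested on representatives. The local homeomorphism property of the right anchor
descends along them too.

Properness of the right action on the composite reduces to closedness, since injectivity already
follows from freeness. Closedness is lifted to the fibre products, where an ultrafilter argument
uses properness first for `X`, to find the limit in `G`, and then for `Y`, to find the limit in `K`.

A bijective 2-arrow is automatically a homeomorphism, because it lies over two local homeomorphisms.
So no continuous inverse of a unitor or associator is ever constructed. The coherence laws then hold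
on classes: most by unfolding, naturality of the unitors by equivariance, and the triangle by `[x ·
a, z] = [x, a · z]`. -/

section TopologicalLemmas

/-! ### Open maps, local homeomorphisms and open quotient maps -/

variable {A B C : Type*} [TopologicalSpace A] [TopologicalSpace B] [TopologicalSpace C]

/-- Openness is stable under base change: a basic neighbourhood `U × V` has image `g ⁻¹' (f '' U) ∩
V`. -/
theorem IsOpenMap.snd_fibreProduct {f : A → C} {g : B → C} (hf : IsOpenMap f)
    (hg : Continuous g) : IsOpenMap fun p : {p : A × B // f p.1 = g p.2} => p.1.2 := by
  refine IsOpenMap.of_nhds_le ?_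
  rintro ⟨⟨a, b⟩, e⟩ S hS
  rw [Filter.mem_map, nhds_subtype_eq_comap, Filter.mem_comap] at hS
  obtain ⟨T, hT, hTS⟩ := hS
  obtain ⟨U, hU, V, hV, hUV⟩ := mem_nhds_prod_iff.1 hT
  have e' : f a = g b := e
  have h : g ⁻¹' (f '' U) ∈ 𝓝 b :=
    hg.continuousAt (by rw [← e']; exact hf.image_mem_nhds hU)
  filter_upwards [h, hV]
  rintro b' ⟨a', ha', hab⟩ hb'
  exact hTS (show (⟨(a', b'), hab⟩ : {p : A × B // f p.1 = g p.2}) ∈ Subtype.val ⁻¹' T from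
    hUV ⟨ha', hb'⟩)

theorem isLocalHomeomorph_of_isOpenMap_of_injOn {f : A → B} (hc : Continuous f)
    (ho : IsOpenMap f) (hi : ∀ a, ∃ U ∈ 𝓝 a, Set.InjOn f U) : IsLocalHomeomorph f := by
  refine isLocalHomeomorph_iff_isOpenEmbedding_restrict.2 fun a => ?_
  obtain ⟨U, hU, hf⟩ := hi a
  obtain ⟨V, hVU, hV, haV⟩ := mem_nhds_iff.1 hU
  exact ⟨V, hV.mem_nhds haV, .of_continuous_injective_isOpenMap (hc.comp continuous_subtype_val)
    (hf.mono hVU).injective (ho.comp hV.isOpenMap_subtype_val)⟩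

theorem IsLocalHomeomorph.exists_injOn {f : A → B} (hf : IsLocalHomeomorph f) (a : A) :
    ∃ U ∈ 𝓝 a, Set.InjOn f U := by
  obtain ⟨e, ha, rfl⟩ := hf a
  exact ⟨e.source, e.open_source.mem_nhds ha, e.injOn⟩

theorem IsLocalHomeomorph.isHomeomorph {f : A → B} (hf : IsLocalHomeomorph f)
    (hb : Function.Bijective f) : IsHomeomorph f :=
  ⟨hf.continuous, hf.isOpenMap, hb⟩

/-- Openness of `f` turns a neighbourhood on which `g ∘ f` is injective into one on which `g` is
injective; surjectivity of `f` makes `g` open. -/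
theorem IsOpenQuotientMap.isLocalHomeomorph_of_comp {f : A → B} {g : B → C}
    (hf : IsOpenQuotientMap f) (hgf : IsLocalHomeomorph (g ∘ f)) : IsLocalHomeomorph g := by
  refine isLocalHomeomorph_of_isOpenMap_of_injOn (hf.continuous_comp_iff.1 hgf.continuous)
    (.of_comp hf.continuous hf.surjective hgf.isOpenMap) fun b => ?_
  obtain ⟨a, rfl⟩ := hf.surjective b
  obtain ⟨U, hU, hi⟩ := hgf.exists_injOn a
  refine ⟨f '' U, hf.isOpenMap.image_mem_nhds hU, ?_⟩
  rintro _ ⟨a, ha, rfl⟩ _ ⟨a', ha', rfl⟩ h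
  rw [hi ha ha' h]

/-- The restriction of an open quotient map to the preimage of any subset is again a quotient map.
This gives continuity of partially defined operations on orbit spaces. -/
theorem IsOpenQuotientMap.continuous_of_comp_subtype {f : A → B} (hf : IsOpenQuotientMap f)
    {p : B → Prop} {F : {b // p b} → C}
    (h : Continuous fun a : {a // p (f a)} => F ⟨f a.1, a.2⟩) : Continuous F :=
  (hf.restrictPreimage {b | p b}).continuous_comp_iff.1 h

end TopologicalLemmas

/-! ### Limits and cancellation in a single correspondence -/

namespace PreCorrespondence

variable {H G K L : EtaleGroupoid.{u}}

namespace IsCorrespondence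

variable {X : PreCorrespondence H G}

theorem continuous_s (hX : X.IsCorrespondence) : Continuous X.s := hX.isLocalHomeomorph_s.continuous

theorem continuous_lact_of (hX : X.IsCorrespondence) {T : Type*} [TopologicalSpace T]
    {h : T → H.Arr} {x : T → X.carrier}
    (hh : Continuous h) (hx : Continuous x) (e : ∀ t, H.s (h t) = X.r (x t)) :
    Continuous fun t => X.lact (h t) (x t) (e t) :=
  hX.continuous_lact.comp (f := fun t => ⟨(h t, x t), e t⟩)
    (Continuous.subtype_mk (hh.prodMk hx) e)

theorem continuous_ract_of (hX : X.IsCorrespondence) {T : Type*} [TopologicalSpace T]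
    {x : T → X.carrier} {g : T → G.Arr}
    (hx : Continuous x) (hg : Continuous g) (e : ∀ t, X.s (x t) = G.r (g t)) :
    Continuous fun t => X.ract (x t) (g t) (e t) :=
  hX.continuous_ract.comp (f := fun t => ⟨(x t, g t), e t⟩)
    (Continuous.subtype_mk (hx.prodMk hg) e)

theorem tendsto_lact (hX : X.IsCorrespondence) {T : Type*} {l : Filter T}
    {h : T → H.Arr} {x : T → X.carrier} {h₀ x₀}
    (hh : Filter.Tendsto h l (𝓝 h₀)) (hx : Filter.Tendsto x l (𝓝 x₀))
    (e : ∀ t, H.s (h t) = X.r (x t)) (e₀ : H.s h₀ = X.r x₀) :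
    Filter.Tendsto (fun t => X.lact (h t) (x t) (e t)) l (𝓝 (X.lact h₀ x₀ e₀)) :=
  (hX.continuous_lact.tendsto ⟨(h₀, x₀), e₀⟩).comp
    (f := fun t => (⟨(h t, x t), e t⟩ : {p : H.Arr × X.carrier // H.s p.1 = X.r p.2}))
    (tendsto_subtype_rng.2 (hh.prodMk_nhds hx))

/-- The element that translates `x t` into `x t · g t` converges along an ultrafilter if both
points converge. -/
theorem exists_tendsto (hX : X.IsCorrespondence) {T : Type*} {l : Ultrafilter T}
    {x : T → X.carrier} {g : T → G.Arr}
    (e : ∀ t, X.s (x t) = G.r (g t)) {x₀ x₁} (hx : Filter.Tendsto x l (𝓝 x₀))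
    (hxg : Filter.Tendsto (fun t => X.ract (x t) (g t) (e t)) l (𝓝 x₁)) :
    ∃ (g₀ : G.Arr) (e₀ : X.s x₀ = G.r g₀), X.ract x₀ g₀ e₀ = x₁ ∧ Filter.Tendsto g l (𝓝 g₀) := by
  let φ : T → {p : X.carrier × G.Arr // X.s p.1 = G.r p.2} := fun t => ⟨(x t, g t), e t⟩
  -- Properness provides a limit lying exactly over `(x₁, x₀)`, so no uniqueness of limits in `X` is
  -- needed.
  obtain ⟨⟨⟨x', g₀⟩, e₀⟩, h, hl⟩ := hX.proper.ultrafilter_le_nhds_of_tendsto (𝒰 := l.map φ)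
    (y := (x₁, x₀)) (Filter.tendsto_map'_iff.2 (hxg.prodMk_nhds hx))
  obtain ⟨h1, rfl⟩ := Prod.ext_iff.1 h
  refine ⟨g₀, e₀, h1, ?_⟩
  have h2 : Filter.Tendsto φ l (𝓝 ⟨(x', g₀), e₀⟩) := hl
  exact ((continuous_snd.comp continuous_subtype_val).tendsto _).comp h2

theorem ract_left_cancel (hX : X.IsCorrespondence) {x : X.carrier} {g g' : G.Arr}
    {e : X.s x = G.r g} {e' : X.s x = G.r g'} (h : X.ract x g e = X.ract x g' e') : g = g' :=
  congrArg (fun p => p.1.2)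
    (hX.free (a₁ := ⟨(x, g), e⟩) (a₂ := ⟨(x, g'), e'⟩) (Prod.ext h rfl))

end IsCorrespondence

/-! ### The composite is a groupoid correspondence -/

section

variable {X : PreCorrespondence H G} {Y : PreCorrespondence G K}

theorem unit_lact' (X : PreCorrespondence H G) (o x) (e : H.s (H.unit o) = X.r x) :
    X.lact (H.unit o) x e = x := by
  obtain rfl : o = X.r x := by simpa using e
  exact X.unit_lact x

theorem ract_unit' (X : PreCorrespondence H G) (o x) (e : X.s x = G.r (G.unit o)) :
    X.ract x (G.unit o) e = x := by
  obtain rfl : X.s x = o := by simpa using e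
  exact X.ract_unit x

theorem inv_lact_lact (X : PreCorrespondence H G) (h x) (e : H.s h = X.r x) :
    X.lact (H.inv h) (X.lact h x e) (by simp) = x := by
  rw [X.lact_lact _ _ _ (by simp)]
  simp only [H.inv_mul, unit_lact']

theorem ract_ract_inv (X : PreCorrespondence H G) (x g) (e : X.s x = G.r g) :
    X.ract (X.ract x g e) (G.inv g) (by simp) = x := by
  rw [X.ract_ract _ _ _ _ (by simp)]
  simp only [G.mul_inv, ract_unit']

theorem continuous_cls {T : Type*} [TopologicalSpace T] {x : T → X.carrier} {y : T → Y.carrier}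
    (hx : Continuous x) (hy : Continuous y) (e : ∀ t, X.s (x t) = Y.r (y t)) :
    Continuous fun t => cls X Y (x t) (y t) (e t) :=
  continuous_quotient_mk'.comp (Continuous.subtype_mk (hx.prodMk hy) e)

/-- The saturation of an open set `U` is the projection of the open set of pairs `(g, p)` with `g ·
p ∈ U`. This projection is a base change of the open source map of `G`. -/
theorem isOpenQuotientMap_mk (hX : X.IsCorrespondence) (hY : Y.IsCorrespondence) :
    IsOpenQuotientMap (Quotient.mk (orbitSetoid X Y)) := by
  refine ⟨Quotient.mk_surjective, continuous_quotient_mk', fun U hU => ?_⟩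
  let D := {p : G.Arr × FibreProduct X Y // G.s p.1 = Y.r p.2.1.2}
  let act : D → FibreProduct X Y := fun p => diag X Y p.1.1 p.1.2 p.2
  have hact : Continuous act := by
    refine Continuous.subtype_mk (.prodMk ?_ ?_) _
    · exact hX.continuous_ract_of (by fun_prop) (G.continuous_inv.comp (by fun_prop)) _
    · exact hY.continuous_lact_of (by fun_prop) (by fun_prop) _
  have hpr : IsOpenMap fun p : D => p.1.2 :=
    G.isLocalHomeomorph_s.isOpenMap.snd_fibreProduct (g := fun p : FibreProduct X Y => Y.r p.1.2)
      (hY.continuous_r.comp (by fun_prop))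
  have h : Quotient.mk (orbitSetoid X Y) ⁻¹' (Quotient.mk (orbitSetoid X Y) '' U) =
      (fun p : D => p.1.2) '' (act ⁻¹' U) := by
    ext p
    constructor
    · rintro ⟨q, hq, hqp⟩
      obtain ⟨g, e, rfl⟩ := Quotient.exact hqp.symm
      exact ⟨⟨(g, p), e⟩, hq, rfl⟩
    · rintro ⟨⟨⟨g, p⟩, e⟩, hq, rfl⟩
      exact ⟨_, hq, (Quotient.sound ⟨g, e, rfl⟩ : Quotient.mk (orbitSetoid X Y) p = _).symm⟩
  rw [← isQuotientMap_quotient_mk'.isOpen_preimage]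
  exact h ▸ hpr _ (hU.preimage hact)

theorem isLocalHomeomorph_compS (hX : X.IsCorrespondence) (hY : Y.IsCorrespondence) :
    IsLocalHomeomorph (compS X Y) := by
  refine (isOpenQuotientMap_mk hX hY).isLocalHomeomorph_of_comp ?_
  change IsLocalHomeomorph fun p : FibreProduct X Y => Y.s p.1.2
  refine isLocalHomeomorph_of_isOpenMap_of_injOn (hY.continuous_s.comp (by fun_prop))
    (hY.isLocalHomeomorph_s.isOpenMap.comp
      (hX.isLocalHomeomorph_s.isOpenMap.snd_fibreProduct hY.continuous_r)) ?_
  rintro ⟨⟨x, y⟩, e⟩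
  obtain ⟨U, hU, hUi⟩ := hX.isLocalHomeomorph_s.exists_injOn x
  obtain ⟨V, hV, hVi⟩ := hY.isLocalHomeomorph_s.exists_injOn y
  refine ⟨Subtype.val ⁻¹' (U ×ˢ V), continuous_subtype_val.continuousAt (prod_mem_nhds hU hV), ?_⟩
  rintro ⟨⟨x₁, y₁⟩, e₁⟩ h₁ ⟨⟨x₂, y₂⟩, e₂⟩ h₂ h
  -- Locally `s y` determines `y`, hence also `r y = s x`, which in turn locally determines `x`.
  obtain rfl : y₁ = y₂ := hVi h₁.2 h₂.2 h
  obtain rfl : x₁ = x₂ := hUi h₁.1 h₂.1 (e₁.trans e₂.symm)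
  rfl

theorem compActionMap_injective (hX : X.IsCorrespondence) (hY : Y.IsCorrespondence) :
    Function.Injective (X.comp Y).actionMap := by
  rintro ⟨⟨q, k⟩, e⟩ ⟨⟨q', k'⟩, e'⟩ h
  obtain ⟨h1, rfl⟩ := Prod.ext_iff.1 h
  obtain ⟨x, y, e₀, rfl⟩ := cls_surj X Y q
  -- The element `g` comparing `(x, y · k)` with `(x, y · k')` fixes `x`, so it is a unit by
  -- freeness of `X`; then freeness of `Y` gives `k = k'`.
  obtain ⟨g, hg, hgx, hgy⟩ := (cls_eq_iff X Y).1 h1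
  have hg₀ : G.inv g = G.unit (X.s x) :=
    hX.ract_left_cancel (hgx.trans (X.ract_unit x).symm)
  have hg₁ : g = G.unit (X.s x) := by rw [← G.inv_inv g, hg₀, G.inv_unit]
  subst hg₁
  rw [unit_lact'] at hgy
  obtain rfl := hY.ract_left_cancel hgy
  rfl

/-- Pulled back to pairs of representatives, the image of a closed set becomes its image under `Φ :
(p, g, k) ↦ (g · (p · k), p)`. The extra variable `g` records the choice of representative, and `Φ`
is proper. -/
theorem isClosedMap_compActionMap (hX : X.IsCorrespondence) (hY : Y.IsCorrespondence) :
    IsClosedMap (X.comp Y).actionMap := by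
  let E := {t : FibreProduct X Y × G.Arr × K.Arr //
    G.s t.2.1 = Y.r t.1.1.2 ∧ Y.s t.1.1.2 = K.r t.2.2}
  let Φ : E → FibreProduct X Y × FibreProduct X Y := fun t =>
    (diag X Y t.1.2.1 ⟨(t.1.1.1.1, Y.ract t.1.1.1.2 t.1.2.2 t.2.2), t.1.1.2.trans (by simp)⟩
      (t.2.1.trans (by simp)), t.1.1)
  have hΦc : Continuous Φ := by
    refine .prodMk (Continuous.subtype_mk (.prodMk ?_ ?_) _) (by fun_prop)
    · exact hX.continuous_ract_of (by fun_prop) (G.continuous_inv.comp (by fun_prop)) _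
    · exact hY.continuous_lact_of (by fun_prop)
        (hY.continuous_ract_of (by fun_prop) (by fun_prop) _) _
  have hΦ : IsProperMap Φ := by
    refine isProperMap_iff_ultrafilter.2 ⟨hΦc, ?_⟩
    rintro l ⟨⟨⟨x₁, y₁⟩, e₁⟩, ⟨⟨x₀, y₀⟩, e₀⟩⟩ hl
    have hx₀ : Filter.Tendsto (fun t : E => t.1.1.1.1) l (𝓝 x₀) :=
      ((show Continuous fun p : FibreProduct X Y × FibreProduct X Y => p.2.1.1 by
        fun_prop).tendsto _).comp hl
    have hy₀ : Filter.Tendsto (fun t : E => t.1.1.1.2) l (𝓝 y₀) :=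
      ((show Continuous fun p : FibreProduct X Y × FibreProduct X Y => p.2.1.2 by
        fun_prop).tendsto _).comp hl
    have hx₁ := ((show Continuous fun p : FibreProduct X Y × FibreProduct X Y => p.1.1.1 by
        fun_prop).tendsto _).comp hl
    have hy₁ := ((show Continuous fun p : FibreProduct X Y × FibreProduct X Y => p.1.1.2 by
        fun_prop).tendsto _).comp hl
    -- In the `X` coordinate both `x` and `x · g⁻¹` converge, so `g⁻¹` converges to some `a`.
    obtain ⟨a, ea, rfl, hla⟩ := hX.exists_tendsto
      (fun t : E => (t.1.1.2.trans t.2.1.symm).trans (G.r_inv _).symm) hx₀ hx₁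
    have e₁' : G.s a = Y.r y₁ := by simpa using e₁
    -- Applying `g⁻¹ → a` to `g · (y · k) → y₁` shows that `y · k` converges, which is what
    -- properness of `Y` needs to produce a limit of `k`.
    have hy₂ := hY.tendsto_lact hla hy₁ (fun t : E => by simp [Φ, diag]) e₁'
    have hy₃ : Filter.Tendsto
        (fun t : E => Y.ract t.1.1.1.2 t.1.2.2 t.2.2) l (𝓝 (Y.lact a y₁ e₁')) := by
      refine hy₂.congr fun t => ?_
      exact inv_lact_lact Y _ _ _
    obtain ⟨k, ek, hk, hlk⟩ := hY.exists_tendsto (fun t : E => t.2.2) hy₀ hy₃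
    have hlg : Filter.Tendsto (fun t : E => t.1.2.1) l (𝓝 (G.inv a)) :=
      ((G.continuous_inv.tendsto a).comp hla).congr fun t => G.inv_inv _
    refine ⟨⟨(⟨(x₀, y₀), e₀⟩, G.inv a, k), ?_, ek⟩, ?_, ?_⟩
    · rw [G.s_inv, ← ea]
      exact e₀
    · refine Prod.ext (Subtype.ext (Prod.ext ?_ ?_)) rfl
      · simp [Φ, diag]
      · simp only [Φ, diag, hk]
        exact inv_lact_lact Y _ _ _
    · have : Filter.Tendsto id (l : Filter E)
          (𝓝 (⟨(⟨(x₀, y₀), e₀⟩, G.inv a, k), (by rw [G.s_inv, ← ea]; exact e₀), ek⟩ : E)) :=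
        tendsto_subtype_rng.2 ((tendsto_subtype_rng.2 (hx₀.prodMk_nhds hy₀)).prodMk_nhds
          (hlg.prodMk_nhds hlk))
      exact this
  let ρ : E → {p : CompSpace X Y × K.Arr // compS X Y p.1 = K.r p.2} := fun t =>
    ⟨(Quotient.mk _ t.1.1, t.1.2.2), t.2.2⟩
  have hρ : Continuous ρ :=
    Continuous.subtype_mk (.prodMk (continuous_quotient_mk'.comp (by fun_prop)) (by fun_prop)) _
  intro S hS
  have hπ := (isOpenQuotientMap_mk hX hY).prodMap (isOpenQuotientMap_mk hX hY)
  rw [← hπ.isQuotientMap.isClosed_preimage]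
  -- Closedness may be tested after pullback along the product of two orbit maps, and there the set
  -- is the `Φ`-image of a closed subset of `E`.
  convert hΦ.isClosedMap _ (hS.preimage hρ) using 1
  ext ⟨p', p⟩
  constructor
  · rintro ⟨⟨⟨q, k⟩, ek⟩, hq, h⟩
    obtain ⟨h1, rfl⟩ := Prod.ext_iff.1 h
    obtain ⟨g, hg, h2⟩ := Quotient.exact h1
    exact ⟨⟨(p, g, k), hg.trans (Y.r_ract _ _ _), ek⟩, hq, Prod.ext h2 rfl⟩
  · rintro ⟨⟨⟨p, g, k⟩, hg, hk⟩, hq, h⟩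
    obtain ⟨h1, rfl⟩ := Prod.ext_iff.1 h
    refine ⟨_, hq, Prod.ext (Quotient.sound ⟨g, hg.trans (Y.r_ract _ _ _).symm, h1⟩) rfl⟩

theorem isCorrespondence_comp (hX : X.IsCorrespondence) (hY : Y.IsCorrespondence) :
    (X.comp Y).IsCorrespondence := by
  have hπ := isOpenQuotientMap_mk hX hY
  have hract : Continuous fun p : {p : CompSpace X Y × K.Arr // compS X Y p.1 = K.r p.2} =>
      compRact X Y p.1.1 p.1.2 p.2 := by
    refine (hπ.prodMap .id).continuous_of_comp_subtype ?_
    exact continuous_cls (by fun_prop) (hY.continuous_ract_of (by fun_prop) (by fun_prop)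
      fun t => t.2) _
  refine
    { continuous_r := (hX.continuous_r.comp (by fun_prop)).quotient_lift _
      continuous_lact := ?_
      continuous_ract := hract
      isLocalHomeomorph_s := isLocalHomeomorph_compS hX hY
      free := compActionMap_injective hX hY
      proper := ?_ }
  · refine (IsOpenQuotientMap.id.prodMap hπ).continuous_of_comp_subtype ?_
    exact continuous_cls (hX.continuous_lact_of (by fun_prop) (by fun_prop) fun t => t.2)
      (by fun_prop) _
  · exact (IsClosedEmbedding.of_continuous_injective_isClosedMap (hract.prodMk (by fun_prop))
      (compActionMap_injective hX hY) (isClosedMap_compActionMap hX hY)).isProperMap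

end

end PreCorrespondence

/-! ### The identity correspondence, horizontal composites, unitors and associator -/

namespace PreCorrespondence

variable {H G K L : EtaleGroupoid.{u}}

/-- If `x · g → a` and `x → b`, then `g = x⁻¹ · (x · g)` must converge to `b⁻¹ · a`. -/
theorem isProperMap_identity_actionMap (G : EtaleGroupoid.{u}) :
    IsProperMap (identity G).actionMap := by
  have hc : Continuous (identity G).actionMap := G.continuous_mul.prodMk (by fun_prop)
  refine isProperMap_iff_ultrafilter.2 ⟨hc, ?_⟩
  rintro l ⟨a, b⟩ hl
  have ha : Filter.Tendsto (fun p : {p : G.Arr × G.Arr // G.s p.1 = G.r p.2} =>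
      G.mul p.1.1 p.1.2 p.2) l (𝓝 a) := (continuous_fst.tendsto _).comp hl
  have hb : Filter.Tendsto (fun p : {p : G.Arr × G.Arr // G.s p.1 = G.r p.2} => p.1.1) l (𝓝 b) :=
    (continuous_snd.tendsto _).comp hl
  -- For `b⁻¹ · a` to be defined, the ranges must agree. Both are limits of `r x` in the object
  -- space, which is Hausdorff.
  have hr : G.r b = G.r a := by
    have := G.t2Space_obj
    refine tendsto_nhds_unique ((G.isLocalHomeomorph_r.continuous.tendsto b).comp hb) ?_
    refine ((G.isLocalHomeomorph_r.continuous.tendsto a).comp ha).congr fun p => ?_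
    exact G.r_mul _ _ _
  have hg : Filter.Tendsto (fun p : {p : G.Arr × G.Arr // G.s p.1 = G.r p.2} => p.1.2) l
      (𝓝 (G.mul (G.inv b) a ((G.s_inv b).trans hr))) := by
    have h := (G.continuous_mul.tendsto ⟨(G.inv b, a), (G.s_inv b).trans hr⟩).comp
      (f := fun p : {p : G.Arr × G.Arr // G.s p.1 = G.r p.2} =>
        (⟨(G.inv p.1.1, G.mul p.1.1 p.1.2 p.2), by simp⟩ :
          {p : G.Arr × G.Arr // G.s p.1 = G.r p.2})) (x := (l : Filter
            {p : G.Arr × G.Arr // G.s p.1 = G.r p.2}))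
      (tendsto_subtype_rng.2 (((G.continuous_inv.tendsto b).comp hb).prodMk_nhds ha))
    exact h.congr fun p => inv_lact_lact (identity G) p.1.1 p.1.2 p.2
  refine ⟨⟨(b, G.mul (G.inv b) a ((G.s_inv b).trans hr)), by simp⟩, Prod.ext ?_ rfl, ?_⟩
  · have h := inv_lact_lact (identity G) (G.inv b) a ((G.s_inv b).trans hr)
    simp only [G.inv_inv] at h
    exact h
  · have : Filter.Tendsto id (l : Filter _)
        (𝓝 (⟨(b, G.mul (G.inv b) a ((G.s_inv b).trans hr)), by simp⟩ :
          {p : G.Arr × G.Arr // G.s p.1 = G.r p.2})) :=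
      tendsto_subtype_rng.2 (hb.prodMk_nhds hg)
    exact this

theorem isCorrespondence_identity (G : EtaleGroupoid.{u}) : (identity G).IsCorrespondence where
  continuous_r := G.isLocalHomeomorph_r.continuous
  continuous_lact := G.continuous_mul
  continuous_ract := G.continuous_mul
  isLocalHomeomorph_s := G.isLocalHomeomorph_s
  free := by
    rintro ⟨⟨x, g⟩, e⟩ ⟨⟨x', g'⟩, e'⟩ h
    obtain ⟨h1, rfl⟩ := Prod.ext_iff.1 h
    have h2 := inv_lact_lact (identity G) x g e
    have h3 := inv_lact_lact (identity G) x g' e'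
    have h1' : G.mul x g e = G.mul x g' e' := h1
    obtain rfl : g = g' := by
      rw [← h2, ← h3]
      simp only [h1']
    rfl
  proper := isProperMap_identity_actionMap G

theorem cls_congr {X : PreCorrespondence H G} {Y : PreCorrespondence G K} {x x' y y'}
    (e : X.s x = Y.r y) (hx : x = x') (hy : y = y') :
    cls X Y x y e = cls X Y x' y' (by rw [← hx, ← hy, e]) := by
  subst hx hy; rfl

theorem isTwoArrow_hcomp {X₁ X₂ : PreCorrespondence H G} {Y₁ Y₂ : PreCorrespondence G K}
    {α : X₁.carrier → X₂.carrier} {β : Y₁.carrier → Y₂.carrier}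
    (hα : IsTwoArrow X₁ X₂ α) (hβ : IsTwoArrow Y₁ Y₂ β) :
    IsTwoArrow (X₁.comp Y₁) (X₂.comp Y₂) (hcomp hα hβ) where
  continuous := (continuous_cls (hα.continuous.comp (by fun_prop))
    (hβ.continuous.comp (by fun_prop)) _).quotient_lift _
  injective q q' h := by
    obtain ⟨x, y, e, rfl⟩ := cls_surj X₁ Y₁ q
    obtain ⟨x', y', e', rfl⟩ := cls_surj X₁ Y₁ q'
    -- The same `g` relates the original pairs: equivariance moves it inside `α` and `β`, and
    -- injectivity removes them.
    obtain ⟨g, hg, hx, hy⟩ := (cls_eq_iff X₂ Y₂).1 h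
    exact (cls_eq_iff X₁ Y₁).2 ⟨g, hg.trans (hβ.map_r _),
      hα.injective ((hα.map_ract _ _ _).trans hx), hβ.injective ((hβ.map_lact _ _ _).trans hy)⟩
  map_r q := by
    obtain ⟨x, y, e, rfl⟩ := cls_surj X₁ Y₁ q
    exact hα.map_r x
  map_s q := by
    obtain ⟨x, y, e, rfl⟩ := cls_surj X₁ Y₁ q
    exact hβ.map_s y
  map_lact h q e := by
    obtain ⟨x, y, e', rfl⟩ := cls_surj X₁ Y₁ q
    exact cls_congr _ (hα.map_lact _ _ _) rfl
  map_ract q k e := by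
    obtain ⟨x, y, e', rfl⟩ := cls_surj X₁ Y₁ q
    exact cls_congr _ rfl (hβ.map_ract _ _ _)

/-- A bijective 2-arrow between correspondences is a homeomorphism, because it is compatible with
the right anchor maps, which are local homeomorphisms. -/
theorem IsTwoArrow.isHomeomorph {X Y : PreCorrespondence H G} {f : X.carrier → Y.carrier}
    (hf : IsTwoArrow X Y f) (hX : X.IsCorrespondence) (hY : Y.IsCorrespondence)
    (hs : Function.Surjective f) : IsHomeomorph f := by
  refine IsLocalHomeomorph.isHomeomorph (.of_comp (g := Y.s) ?_ hY.isLocalHomeomorph_s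
    hf.continuous) ⟨hf.injective, hs⟩
  rw [show Y.s ∘ f = X.s from funext hf.map_s]
  exact hX.isLocalHomeomorph_s

theorem isTwoArrow_unitorR {X : PreCorrespondence H G} (hX : X.IsCorrespondence) :
    IsTwoArrow (X.comp (identity G)) X X.unitorR where
  continuous := hX.continuous_ract.quotient_lift _
  injective q q' h := by
    obtain ⟨x, a, e, rfl⟩ := cls_surj X (identity G) q
    obtain ⟨x', a', e', rfl⟩ := cls_surj X (identity G) q'
    have h1 : X.ract x a e = X.ract x' a' e' := h
    have hs : G.s a = G.s a' := by simpa using congrArg X.s h1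
    -- From `x · a = x' · a'`, the element `a' a⁻¹` takes `a` to `a'`, and its inverse takes `x` to
    -- `x'`.
    refine (cls_eq_iff X (identity G)).2 ⟨G.mul a' (G.inv a) (by simp [hs]), by simp, ?_, ?_⟩
    · have h2 := ract_ract_inv X x' a' e'
      simp only [← h1] at h2
      rw [X.ract_ract _ _ _ _ (by simpa using hs)] at h2
      simpa only [G.inv_mul_rev, G.inv_inv] using h2
    · change G.mul (G.mul a' (G.inv a) _) a _ = a'
      rw [G.mul_assoc _ _ _ _ (by simp)]
      simp only [G.inv_mul]
      exact ract_unit' (identity G) _ _ _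
  map_r q := by
    obtain ⟨x, a, e, rfl⟩ := cls_surj X (identity G) q
    exact X.r_ract x a e
  map_s q := by
    obtain ⟨x, a, e, rfl⟩ := cls_surj X (identity G) q
    exact X.s_ract x a e
  map_lact h q e := by
    obtain ⟨x, a, e', rfl⟩ := cls_surj X (identity G) q
    exact X.lact_ract h x a _ _
  map_ract q g e := by
    obtain ⟨x, a, e', rfl⟩ := cls_surj X (identity G) q
    exact (X.ract_ract x a g _ _).symm

theorem isTwoArrow_unitorL {X : PreCorrespondence H G} (hX : X.IsCorrespondence) :
    IsTwoArrow ((identity H).comp X) X X.unitorL where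
  continuous := hX.continuous_lact.quotient_lift _
  injective q q' h := by
    obtain ⟨a, x, e, rfl⟩ := cls_surj (identity H) X q
    obtain ⟨a', x', e', rfl⟩ := cls_surj (identity H) X q'
    have h1 : X.lact a x e = X.lact a' x' e' := h
    have hr : H.r a = H.r a' := by simpa using congrArg X.r h1
    -- From `a · x = a' · x'`, the element `a'⁻¹ a` takes `x` to `x'`, and multiplying `a` on the
    -- right by its inverse gives `a'`.
    refine (cls_eq_iff (identity H) X).2 ⟨H.mul (H.inv a') a (by simp [hr]), by simpa using e,
      ?_, ?_⟩
    · change H.mul a (H.inv (H.mul (H.inv a') a _)) _ = a'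
      simp only [H.inv_mul_rev, H.inv_inv]
      rw [← H.mul_assoc _ _ _ (by simp) (by simp [hr])]
      simp only [H.mul_inv]
      exact unit_lact' (identity H) _ _ _
    · rw [← X.lact_lact _ _ _ (by simp [hr]) e]
      simp only [h1]
      exact inv_lact_lact X _ _ _
  map_r q := by
    obtain ⟨a, x, e, rfl⟩ := cls_surj (identity H) X q
    exact X.r_lact a x e
  map_s q := by
    obtain ⟨a, x, e, rfl⟩ := cls_surj (identity H) X q
    exact X.s_lact a x e
  map_lact h q e := by
    obtain ⟨a, x, e', rfl⟩ := cls_surj (identity H) X q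
    exact (X.lact_lact h a x _ _).symm
  map_ract q g e := by
    obtain ⟨a, x, e', rfl⟩ := cls_surj (identity H) X q
    exact (X.lact_ract a x g _ _).symm

theorem unitorR_surjective (X : PreCorrespondence H G) : Function.Surjective X.unitorR :=
  fun x => ⟨cls X (identity G) x (G.unit (X.s x)) (by simp), X.ract_unit x⟩

theorem unitorL_surjective (X : PreCorrespondence H G) : Function.Surjective X.unitorL :=
  fun x => ⟨cls (identity H) X (H.unit (X.r x)) x (by simp), X.unit_lact x⟩

theorem isTwoArrow_assoc {X : PreCorrespondence H G} {Y : PreCorrespondence G K}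
    {Z : PreCorrespondence K L} (hY : Y.IsCorrespondence) (hZ : Z.IsCorrespondence) :
    IsTwoArrow (X.comp (Y.comp Z)) ((X.comp Y).comp Z) (assoc X Y Z) where
  continuous := by
    refine Continuous.quotient_lift (f := fun p : FibreProduct X (Y.comp Z) =>
      assocAux X Y Z p.1.1 p.1.2 p.2) ?_ _
    -- The inner class must also be replaced by a representative. This is possible because `id`
    -- times the inner orbit map is an open quotient map, and the map becomes `(x, y, z) ↦ [[x, y],
    -- z]`.
    refine (IsOpenQuotientMap.id.prodMap (isOpenQuotientMap_mk hY hZ)).continuous_of_comp_subtype ?_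
    exact continuous_cls (X := X.comp Y) (continuous_cls (by fun_prop) (by fun_prop) fun t => t.2)
      (by fun_prop) fun t => t.1.2.2
  injective q q' h := by
    obtain ⟨x, p, e, rfl⟩ := cls_surj X (Y.comp Z) q
    obtain ⟨y, z, e₁, rfl⟩ := cls_surj Y Z p
    obtain ⟨x', p', e', rfl⟩ := cls_surj X (Y.comp Z) q'
    obtain ⟨y', z', e₁', rfl⟩ := cls_surj Y Z p'
    obtain ⟨k, hk, hxy, hz⟩ := (cls_eq_iff (X.comp Y) Z).1 h
    obtain ⟨g, hg, hx, hy⟩ := (cls_eq_iff X Y).1 hxy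
    -- The witnesses exchange roles: `g` now acts outside and `k` inside. The commutation of the two
    -- actions on `Y` reconciles `(g · y) · k⁻¹` with `g · (y · k⁻¹)`.
    refine (cls_eq_iff X (Y.comp Z)).2 ⟨g, hg.trans (Y.r_ract _ _ _), hx, ?_⟩
    exact (cls_eq_iff Y Z).2 ⟨k, hk, (Y.lact_ract _ _ _ _ _).trans hy, hz⟩
  map_r q := by
    obtain ⟨x, p, e, rfl⟩ := cls_surj X (Y.comp Z) q
    obtain ⟨y, z, e₁, rfl⟩ := cls_surj Y Z p
    rfl
  map_s q := by
    obtain ⟨x, p, e, rfl⟩ := cls_surj X (Y.comp Z) q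
    obtain ⟨y, z, e₁, rfl⟩ := cls_surj Y Z p
    rfl
  map_lact h q e' := by
    obtain ⟨x, p, e, rfl⟩ := cls_surj X (Y.comp Z) q
    obtain ⟨y, z, e₁, rfl⟩ := cls_surj Y Z p
    rfl
  map_ract q l e' := by
    obtain ⟨x, p, e, rfl⟩ := cls_surj X (Y.comp Z) q
    obtain ⟨y, z, e₁, rfl⟩ := cls_surj Y Z p
    rfl

theorem assoc_surjective (X : PreCorrespondence H G) (Y : PreCorrespondence G K)
    (Z : PreCorrespondence K L) : Function.Surjective (assoc X Y Z) := by
  intro q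
  obtain ⟨p, z, e, rfl⟩ := cls_surj (X.comp Y) Z q
  obtain ⟨x, y, e₁, rfl⟩ := cls_surj X Y p
  exact ⟨cls X (Y.comp Z) x (cls Y Z y z e) e₁, rfl⟩

end PreCorrespondence

open PreCorrespondence in
theorem correspondencesWellDefined : CorrespondencesWellDefined.{u} where
  identity := isCorrespondence_identity
  comp X Y := isCorrespondence_comp X.isCorrespondence Y.isCorrespondence
  hcomp α β := isTwoArrow_hcomp α.isTwoArrow β.isTwoArrow
  unitorR X :=
    have h := isTwoArrow_unitorR X.isCorrespondence
    ⟨h, h.isHomeomorph (isCorrespondence_comp X.isCorrespondence (isCorrespondence_identity _))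
      X.isCorrespondence (unitorR_surjective _)⟩
  unitorL X :=
    have h := isTwoArrow_unitorL X.isCorrespondence
    ⟨h, h.isHomeomorph (isCorrespondence_comp (isCorrespondence_identity _) X.isCorrespondence)
      X.isCorrespondence (unitorL_surjective _)⟩
  assoc X Y Z :=
    have h := isTwoArrow_assoc Y.isCorrespondence Z.isCorrespondence
    ⟨h, h.isHomeomorph
      (isCorrespondence_comp X.isCorrespondence
        (isCorrespondence_comp Y.isCorrespondence Z.isCorrespondence))
      (isCorrespondence_comp (isCorrespondence_comp X.isCorrespondence Y.isCorrespondence)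
        Z.isCorrespondence) (assoc_surjective _ _ _)⟩

/-! ### The bicategory laws and the comparison of data -/

/-- Turning conjugation laws into commuting squares avoids evaluating inverses of unitors and
associators, which are given only as inverses of bijections. -/
theorem CategoryTheory.Iso.eq_hom_comp_comp_inv {C : Type*} [Category* C] {X X' Y Y' : C}
    (a : X ≅ X') (b : Y ≅ Y') {f : X ⟶ Y} {f' : X' ⟶ Y'} (h : f ≫ b.hom = a.hom ≫ f') :
    f = a.hom ≫ f' ≫ b.inv := by
  rw [← Category.assoc, Iso.eq_comp_inv, h]

theorem CategoryTheory.Iso.eq_inv_comp_comp_hom {C : Type*} [Category* C] {X X' Y Y' : C}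
    (a : X' ≅ X) (b : Y' ≅ Y) {f : X ⟶ Y} {f' : X' ⟶ Y'} (h : a.hom ≫ f = f' ≫ b.hom) :
    f = a.inv ≫ f' ≫ b.hom := by
  rw [Iso.eq_inv_comp, h]

theorem Correspondence.hom_ext {H G : EtaleGroupoid.{u}} {X Y : Correspondence H G} {α β : X ⟶ Y}
    (h : ∀ x, α.toFun x = β.toFun x) :
    α = β :=
  TwoArrow.ext (funext h)

/-- The bicategory of groupoid correspondences. -/
noncomputable abbrev correspondenceBicategory (W : CorrespondencesWellDefined.{u}) :
    Bicategory.{u, u + 1} EtaleGroupoid.{u} where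
  Hom G H := Correspondence H G
  homCategory _ _ := inferInstance
  id := (correspondenceData W).id
  comp := (correspondenceData W).comp
  whiskerLeft f _ _ η := (correspondenceData W).hcomp (𝟙 f) η
  whiskerRight η h := (correspondenceData W).hcomp η (𝟙 h)
  associator := (correspondenceData W).associator
  leftUnitor := (correspondenceData W).leftUnitor
  rightUnitor := (correspondenceData W).rightUnitor
  whiskerLeft_id f g := by
    refine Correspondence.hom_ext fun q => ?_
    obtain ⟨x, y, e, rfl⟩ := PreCorrespondence.cls_surj _ _ q
    rfl
  whiskerLeft_comp f g h i η θ := by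
    refine Correspondence.hom_ext fun q => ?_
    obtain ⟨x, y, e, rfl⟩ := PreCorrespondence.cls_surj _ _ q
    rfl
  id_whiskerLeft {_ _ f g} η := by
    refine Iso.eq_hom_comp_comp_inv (C := Correspondence _ _) _ _
      (Correspondence.hom_ext fun q => ?_)
    obtain ⟨x, y, e, rfl⟩ := PreCorrespondence.cls_surj _ _ q
    -- Since composition order is reversed, the left unitor is `[x, g] ↦ x · g`, and its naturality
    -- is right equivariance.
    exact (η.isTwoArrow.map_ract x y e).symm
  comp_whiskerLeft f g h h' η := by
    refine Iso.eq_hom_comp_comp_inv (C := Correspondence _ _) _ _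
      (Correspondence.hom_ext fun q => ?_)
    obtain ⟨x, p, e, rfl⟩ := PreCorrespondence.cls_surj _ _ q
    obtain ⟨y, z, e', rfl⟩ := PreCorrespondence.cls_surj _ _ p
    rfl
  id_whiskerRight f g := by
    refine Correspondence.hom_ext fun q => ?_
    obtain ⟨x, y, e, rfl⟩ := PreCorrespondence.cls_surj _ _ q
    rfl
  comp_whiskerRight η θ i := by
    refine Correspondence.hom_ext fun q => ?_
    obtain ⟨x, y, e, rfl⟩ := PreCorrespondence.cls_surj _ _ q
    rfl
  whiskerRight_id {_ _ f g} η := by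
    refine Iso.eq_hom_comp_comp_inv (C := Correspondence _ _) _ _
      (Correspondence.hom_ext fun q => ?_)
    obtain ⟨x, y, e, rfl⟩ := PreCorrespondence.cls_surj _ _ q
    exact (η.isTwoArrow.map_lact x y e).symm
  whiskerRight_comp η g h := by
    refine Iso.eq_inv_comp_comp_hom (C := Correspondence _ _) _ _
      (Correspondence.hom_ext fun q => ?_)
    obtain ⟨x, p, e, rfl⟩ := PreCorrespondence.cls_surj _ _ q
    obtain ⟨y, z, e', rfl⟩ := PreCorrespondence.cls_surj _ _ p
    rfl
  whisker_assoc f g g' η h := by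
    refine Iso.eq_hom_comp_comp_inv (C := Correspondence _ _) _ _
      (Correspondence.hom_ext fun q => ?_)
    obtain ⟨x, p, e, rfl⟩ := PreCorrespondence.cls_surj _ _ q
    obtain ⟨y, z, e', rfl⟩ := PreCorrespondence.cls_surj _ _ p
    rfl
  whisker_exchange η θ := by
    refine Correspondence.hom_ext fun q => ?_
    obtain ⟨x, y, e, rfl⟩ := PreCorrespondence.cls_surj _ _ q
    rfl
  pentagon f g h i := by
    refine Correspondence.hom_ext fun q => ?_
    obtain ⟨x, p, e, rfl⟩ := PreCorrespondence.cls_surj _ _ q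
    obtain ⟨y, o, e', rfl⟩ := PreCorrespondence.cls_surj _ _ p
    obtain ⟨z, w, e'', rfl⟩ := PreCorrespondence.cls_surj _ _ o
    rfl
  triangle f g := by
    refine Correspondence.hom_ext fun q => ?_
    obtain ⟨x, p, e, rfl⟩ := PreCorrespondence.cls_surj _ _ q
    obtain ⟨a, z, e', rfl⟩ := PreCorrespondence.cls_surj _ _ p
    -- The two sides are `[x · a, z]` and `[x, a · z]`; the diagonal action of `a` itself identifies
    -- them.
    refine (PreCorrespondence.cls_eq_iff _ _).2 ⟨a, e', ?_, rfl⟩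
    exact PreCorrespondence.ract_ract_inv _ x a e

/-- Only the horizontal composition needs an argument: composing the two whiskerings gives `[x, y] ↦
[α x, β y]` on classes. The remaining fields agree by definition. -/
theorem ofBicategory_correspondenceBicategory (W : CorrespondencesWellDefined.{u}) :
    BicategoryData.ofBicategory (correspondenceBicategory W) = correspondenceData W := by
  have h : @BicategoryData.hcomp _ (BicategoryData.ofBicategory (correspondenceBicategory W)) =
      @BicategoryData.hcomp _ (correspondenceData W) := by
    funext a b c f f' g g' η θ
    refine Correspondence.hom_ext fun q => ?_
    obtain ⟨x, y, e, rfl⟩ := PreCorrespondence.cls_surj _ _ q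
    rfl
  exact congrArg (fun t => { correspondenceData W with hcomp := t }) h

theorem mainTheorem2 :
    ∃ W : CorrespondencesWellDefined.{u},
      ∃ I : CategoryTheory.Bicategory.{u, u + 1} EtaleGroupoid.{u},
        BicategoryData.ofBicategory I = correspondenceData W :=
  ⟨correspondencesWellDefined, correspondenceBicategory correspondencesWellDefined,
    ofBicategory_correspondenceBicategory _⟩
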